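/- Theorem. Let $K$ be a computable field, i.e. a field with a surjection $\nu:\mathbb{N}\to K$ such that equality of the named elements is decidable (the set $\{(a,b):\nu(a)=\nu(b)\}$ is recursive) and addition and multiplication of $K$ are computed on names by recursive functions. For $S=\mathbb{Z}$ or $S=\mathbb{Q}$ and $n\in\mathbb{N}$ let $\mathrm{Pos}(K,S)[x_1,\dots,x_n]$ be the ring of finite sums $\sum_i c_i x_1^{s_{i1}}\cdots x_n^{s_{in}}$ with $c_i\in K$, $s_{ij}\in S$, i.e. the group ring $K[S^n]$; for $S=\mathbb{Z}$ it is the ring of Laurent polynomials. Its elements are given to algorithms as finite lists of terms, the coefficients by $\nu$-names and the exponents as integers or as fractions of integers. Fix $n$. Then: 1. Ideal membership in $\mathrm{Pos}(K,\mathbb{Z})[x_1,\dots,x_n]$ is decidable: for every ideal $I$ of this ring the predicate $g\in I$ is recursive; and, uniformly, there is one algorithm that, given $f_1,\dots,f_k,g\in\mathrm{Pos}(K,\mathbb{Z})[x_1,\dots,x_n]$ (for any $k\ge 0$), decides whether $g\in\langle f_1,\dots,f_k\rangle$. 2. There is an algorithm that, given $f_1,\dots,f_k,g\in\mathrm{Pos}(K,\mathbb{Q})[x_1,\dots,x_n]$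 (for any $k\ge 0$), decides whether $g\in\langle f_1,\dots,f_k\rangle$. -/

import Mathlib

/-- The posynomial ring `Pos(R, S)[x₁, …, xₙ]`: finite sums of terms `r • x₁^{s₁} ⋯ xₙ^{sₙ}` with
`r : R` and `s₁, …, sₙ : S`, that is, the semigroup ring of the additive monoid `Sⁿ` over `R`. For
`S = ℤ` this is the Laurent polynomial ring in `n` variables. -/
abbrev PosynomialRing (R S : Type*) [CommRing R] [AddCommMonoid S] (n : ℕ) : Type _ :=
  AddMonoidAlgebra R (Fin n → S)

/-- `ν : ℕ → K` presents `K` as a computable field: each element of `K` is named by at least one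
natural number, it is decidable whether two numbers name the same element, and the sum and the
product are computed on names by recursive functions. (Negatives and inverses are then computable
too, by unbounded search.) A field is computable if and only if it has such a numbering. -/
structure IsComputableNumbering {K : Type*} [Field K] (ν : ℕ → K) : Prop where
  surjective : Function.Surjective ν
  eq_computable : ComputablePred fun p : ℕ × ℕ => ν p.1 = ν p.2
  add_computable : ∃ f : ℕ × ℕ → ℕ, Computable f ∧ ∀ p, ν (f p) = ν p.1 + ν p.2
  mul_computable : ∃ f : ℕ × ℕ → ℕ, Computable f ∧ ∀ p, ν (f p) = ν p.1 * ν p.2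

/-- A finite description of a posynomial in `n` variables: a list of terms, each given by a name of
its coefficient and the tuple of (descriptions of) its exponents. -/
abbrev PosynomialCode (E : Type*) (n : ℕ) : Type _ :=
  List (ℕ × (Fin n → E))

/-- The Laurent polynomial described by a list of terms with integer exponents. -/
noncomputable def laurentOfCode {K : Type*} [Field K] (ν : ℕ → K) {n : ℕ}
    (c : PosynomialCode ℤ n) : PosynomialRing K ℤ n :=
  (c.map fun t => AddMonoidAlgebra.single t.2 (ν t.1)).sum

/-- The pair `(a, b)` describes the rational number `a / (b + 1)`. -/
def ratOfPair (p : ℤ × ℕ) : ℚ :=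
  (p.1 : ℚ) / ((p.2 : ℚ) + 1)

/-- The posynomial with rational exponents described by a list of terms, where the exponents are
written as fractions. -/
noncomputable def posynomialOfCode {K : Type*} [Field K] (ν : ℕ → K) {n : ℕ}
    (c : PosynomialCode (ℤ × ℕ) n) : PosynomialRing K ℚ n :=
  (c.map fun t => AddMonoidAlgebra.single (fun i => ratOfPair (t.2 i)) (ν t.1)).sum

/-! Membership in a finitely generated ideal `I` of `R = K[ℤⁿ]` is shown to be semidecidable from
both sides; Post's theorem then makes it decidable, without Gröbner bases. If `g ∈ I`, a blind
search finds cofactors, and a candidate can be checked because equality of names is decidable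
(`NameOps.exists_represents_iff`). If `g ∉ I`, a certificate is a tuple of commuting invertible
matrices over `K` at which all generators vanish but `g` does not (`NameOps.exists_separates_iff`).
To see that one exists, take a maximal ideal `m` containing the colon ideal `(I : g)`. Krull's
intersection theorem gives `k` with `g ∉ I + m ^ k`, and `R / (I + m ^ k)` is a finitely generated
algebra of Krull dimension zero, hence finite-dimensional over `K`. Multiplication by the variables
on this quotient yields the matrices (`exists_matrix_algHom_of_notMem`). Their entries lie in `K`
itself, so they can be enumerated by names.

Every ideal of `R` is finitely generated since `R` is Noetherian. For rational exponents, the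
finitely many exponents of an input have a common denominator `N`, so the input lives in the group
ring of `(1/N)ℤⁿ ≅ ℤⁿ`. The projection of `K[ℚⁿ]` onto this subring is linear over it, so extending
an ideal to `K[ℚⁿ]` adds no new elements of the subring
(`AddMonoidAlgebra.mapDomain_mem_span_image_iff`). -/

section Computability

/-! ### Computable list operations and unbounded search. -/

/-- Recursion on the index turns a fold into a recursion over `ℕ`, the form to which
`Computable.nat_rec` applies. -/
theorem List.foldl_eq_nat_rec {β σ : Type*} (l : List β) (h : σ → β → σ) (s : σ) :
    l.foldl h s =
      Nat.rec (motive := fun _ => σ) s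
        (fun k acc => Option.casesOn (motive := fun _ => σ) (l[k]?) acc (fun b => h acc b))
        l.length := by
  induction l using List.reverseRecOn with
  | nil => rfl
  | append_singleton l b ih =>
    have key : ∀ m ≤ l.length,
        Nat.rec (motive := fun _ => σ) s
          (fun k acc => Option.casesOn (motive := fun _ => σ) ((l ++ [b])[k]?) acc
            (fun b => h acc b)) m =
        Nat.rec (motive := fun _ => σ) s
          (fun k acc => Option.casesOn (motive := fun _ => σ) (l[k]?) acc
            (fun b => h acc b)) m := by
      intro m hm
      induction m with
      | zero => rfl
      | succ m ihm =>
        simp only [ihm (by omega)]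
        rw [List.getElem?_append_left (by omega)]
    rw [List.foldl_append, List.length_append]
    simp only [List.length_singleton, List.foldl_cons, List.foldl_nil]
    rw [key _ le_rfl, ← ih]
    simp

variable {α β σ : Type*} [Primcodable α] [Primcodable β] [Primcodable σ]

theorem Computable.list_foldl {f : α → List β} {g : α → σ} {h : α → σ → β → σ}
    (hf : Computable f) (hg : Computable g)
    (hh : Computable fun p : α × σ × β => h p.1 p.2.1 p.2.2) :
    Computable fun a => (f a).foldl (h a) (g a) := by
  have step : Computable₂ fun (a : α) (p : ℕ × σ) =>
      (Option.casesOn (motive := fun _ => σ) ((f a)[p.1]?) p.2 (fun b => h a p.2 b) : σ) := by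
    refine Computable.option_casesOn (o := fun q : α × ℕ × σ => (f q.1)[q.2.1]?)
      (f := fun q => q.2.2) (g := fun q b => h q.1 q.2.2 b) ?_ ?_ ?_
    · exact Computable.list_getElem?.comp (hf.comp .fst) (Computable.fst.comp .snd)
    · exact Computable.snd.comp .snd
    · exact hh.comp ((Computable.fst.comp .fst).pair
        ((Computable.snd.comp (Computable.snd.comp .fst)).pair .snd))
  exact (Computable.nat_rec (Computable.list_length.comp hf) hg step).of_eq fun a =>
    (List.foldl_eq_nat_rec _ _ _).symm

theorem Computable.list_map {f : α → List β} {g : α → β → σ}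
    (hf : Computable f) (hg : Computable fun p : α × β => g p.1 p.2) :
    Computable fun a => (f a).map (g a) := by
  have := Computable.list_foldl (h := fun a (l : List σ) b => l ++ [g a b]) hf
    (Computable.const []) (Computable.list_concat.comp (Computable.fst.comp .snd)
      (hg.comp (Computable.fst.pair (Computable.snd.comp .snd))))
  refine this.of_eq fun a => ?_
  induction f a using List.reverseRecOn with
  | nil => rfl
  | append_singleton l b ih => simp [List.foldl_append, ih]

theorem Computable.list_flatMap {f : α → List β} {g : α → β → List σ}
    (hf : Computable f) (hg : Computable fun p : α × β => g p.1 p.2) :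
    Computable fun a => (f a).flatMap (g a) :=
  (Primrec.list_flatten.to_comp.comp (Computable.list_map hf hg)).of_eq fun a => by
    rw [List.flatMap_def]

theorem Computable.bool_and {f g : α → Bool} (hf : Computable f) (hg : Computable g) :
    Computable fun a => f a && g a :=
  Primrec.and.to_comp.comp hf hg

theorem Computable.list_all {f : α → List β} {g : α → β → Bool}
    (hf : Computable f) (hg : Computable fun p : α × β => g p.1 p.2) :
    Computable fun a => (f a).all (g a) := by
  have := Computable.list_foldl (h := fun a (r : Bool) b => r && g a b) hf
    (Computable.const true) (Computable.bool_and (Computable.fst.comp .snd)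
      (hg.comp (Computable.fst.pair (Computable.snd.comp .snd))))
  refine this.of_eq fun a => ?_
  induction f a using List.reverseRecOn with
  | nil => rfl
  | append_singleton l b ih => simp [List.foldl_append, ih]

theorem Computable.list_getD {f : α → List σ} {g : α → ℕ} (d : σ) (hf : Computable f)
    (hg : Computable g) : Computable fun a => (f a).getD (g a) d :=
  (Primrec.list_getD d).to_comp.comp hf hg

/-- The search runs through all codes of witnesses; a number that decodes to nothing counts as a
failure. As the test is total, the search never gets stuck before the first success. -/
theorem REPred.exists_of_computable {c : α → β → Bool}
    (hc : Computable fun p : α × β => c p.1 p.2) : REPred fun a => ∃ b, c a b = true := by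
  have h : Computable₂ fun (a : α) (k : ℕ) =>
      (Option.casesOn (motive := fun _ => Bool) (Encodable.decode (α := β) k) false
        (fun b => c a b) : Bool) := by
    refine Computable.option_casesOn (o := fun q : α × ℕ => Encodable.decode (α := β) q.2)
      (f := fun _ => false) (g := fun q b => c q.1 b) ?_ ?_ ?_
    · exact Computable.decode.comp .snd
    · exact Computable.const _
    · exact hc.comp ((Computable.fst.comp .fst).pair .snd)
  refine (Partrec.rfind h.partrec₂).dom_re.of_eq fun a => ?_
  rw [Nat.rfind_dom']
  constructor
  · rintro ⟨k, hk, -⟩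
    rcases hd : Encodable.decode (α := β) k with _ | b
    · simp [hd] at hk
    · exact ⟨b, by simpa [hd] using hk⟩
  · rintro ⟨b, hb⟩
    exact ⟨Encodable.encode b, by simpa using hb, fun _ => trivial⟩

theorem ComputablePred.comp {p : β → Prop} (hp : ComputablePred p) {f : α → β}
    (hf : Computable f) : ComputablePred fun a => p (f a) := by
  obtain ⟨c, hc, rfl⟩ := ComputablePred.computable_iff.1 hp
  exact ComputablePred.computable_iff.2 ⟨_, hc.comp hf, rfl⟩

end Computability

/-! ### Primitive recursive integer arithmetic. -/

section IntPrimrec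

theorem Int.encode_ofNat (m : ℕ) : Encodable.encode (m : ℤ) = 2 * m := by
  show Equiv.intEquivNat (Int.ofNat m) = _
  rfl

theorem Int.encode_negSucc (m : ℕ) : Encodable.encode (Int.negSucc m) = 2 * m + 1 := by
  show Equiv.intEquivNat (Int.negSucc m) = _
  rfl

/-- Nonnegative integers have even codes and negative ones odd codes, so sign and size are read off
by parity and halving. Arithmetic then goes through positive and negative parts. -/
theorem Primrec.int_toNat : Primrec Int.toNat := by
  have : Primrec fun z : ℤ =>
      bif Nat.bodd (Encodable.encode z) then 0 else Nat.div2 (Encodable.encode z) :=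
    Primrec.cond (Primrec.nat_bodd.comp .encode) (Primrec.const 0)
      (Primrec.nat_div2.comp .encode)
  refine this.of_eq fun z => ?_
  cases z with
  | ofNat m => simp [Int.encode_ofNat, Nat.div2_val]
  | negSucc m => simp [Int.encode_negSucc]

theorem Primrec.int_neg_toNat : Primrec fun z : ℤ => (-z).toNat := by
  have : Primrec fun z : ℤ =>
      bif Nat.bodd (Encodable.encode z) then Nat.div2 (Encodable.encode z) + 1 else 0 :=
    Primrec.cond (Primrec.nat_bodd.comp .encode)
      (Primrec.succ.comp (Primrec.nat_div2.comp .encode)) (Primrec.const 0)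
  refine this.of_eq fun z => ?_
  cases z with
  | ofNat m => simp [Int.encode_ofNat]
  | negSucc m => simp [Int.encode_negSucc, Nat.div2_val]

theorem Primrec.int_subNat : Primrec₂ fun a b : ℕ => (a : ℤ) - (b : ℤ) := by
  have : Primrec₂ fun a b : ℕ =>
      (if b ≤ a then 2 * (a - b) else 2 * (b - a - 1) + 1 : ℕ) := by
    refine Primrec.ite (Primrec.nat_le.comp .snd .fst) ?_ ?_
    · exact Primrec.nat_double.comp (Primrec.nat_sub.comp .fst .snd)
    · exact Primrec.nat_double_succ.comp
        (Primrec.nat_sub.comp (Primrec.nat_sub.comp .snd .fst) (Primrec.const 1))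
  refine Primrec₂.encode_iff.1 (this.of_eq fun a b => ?_)
  split_ifs with h
  · rw [← Int.encode_ofNat, Nat.cast_sub h]
  · rw [← Int.encode_negSucc]
    congr 1
    omega

theorem Primrec.int_add : Primrec₂ fun a b : ℤ => a + b := by
  have : Primrec₂ fun a b : ℤ =>
      ((a.toNat + b.toNat : ℕ) : ℤ) - (((-a).toNat + (-b).toNat : ℕ) : ℤ) :=
    Primrec.int_subNat.comp
      (Primrec.nat_add.comp (Primrec.int_toNat.comp .fst) (Primrec.int_toNat.comp .snd))
      (Primrec.nat_add.comp (Primrec.int_neg_toNat.comp .fst) (Primrec.int_neg_toNat.comp .snd))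
  exact this.of_eq fun a b => by omega

theorem Primrec.int_mul_natCast : Primrec₂ fun (a : ℤ) (m : ℕ) => a * (m : ℤ) := by
  have : Primrec₂ fun (a : ℤ) (m : ℕ) =>
      ((a.toNat * m : ℕ) : ℤ) - (((-a).toNat * m : ℕ) : ℤ) :=
    Primrec.int_subNat.comp
      (Primrec.nat_mul.comp (Primrec.int_toNat.comp .fst) .snd)
      (Primrec.nat_mul.comp (Primrec.int_neg_toNat.comp .fst) .snd)
  refine this.of_eq fun a m => ?_
  push_cast
  rw [← sub_mul, Int.toNat_sub_toNat_neg]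

end IntPrimrec

/-- Recursive functions that compute with names of elements of a numbered field. -/
structure NameOps {K : Type*} [Field K] (ν : ℕ → K) where
  eqb : ℕ → ℕ → Bool
  add : ℕ → ℕ → ℕ
  mul : ℕ → ℕ → ℕ
  zero : ℕ
  one : ℕ
  negOne : ℕ
  eqb_iff : ∀ a b, eqb a b = true ↔ ν a = ν b
  val_add : ∀ a b, ν (add a b) = ν a + ν b
  val_mul : ∀ a b, ν (mul a b) = ν a * ν b
  val_zero : ν zero = 0
  val_one : ν one = 1
  val_negOne : ν negOne = -1
  computable_eqb : Computable₂ eqb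
  computable_add : Computable₂ add
  computable_mul : Computable₂ mul

theorem IsComputableNumbering.nonempty_nameOps {K : Type*} [Field K] {ν : ℕ → K}
    (hν : IsComputableNumbering ν) : Nonempty (NameOps ν) := by
  obtain ⟨e, he, hp⟩ := ComputablePred.computable_iff.1 hν.eq_computable
  obtain ⟨f, hf, hf'⟩ := hν.add_computable
  obtain ⟨g, hg, hg'⟩ := hν.mul_computable
  obtain ⟨z, hz⟩ := hν.surjective 0
  obtain ⟨o, ho⟩ := hν.surjective 1
  obtain ⟨m, hm⟩ := hν.surjective (-1)
  exact ⟨{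
    eqb := fun a b => e (a, b)
    add := fun a b => f (a, b)
    mul := fun a b => g (a, b)
    zero := z
    one := o
    negOne := m
    eqb_iff := fun a b => (iff_of_eq (congrFun hp (a, b))).symm
    val_add := fun a b => hf' (a, b)
    val_mul := fun a b => hg' (a, b)
    val_zero := hz
    val_one := ho
    val_negOne := hm
    computable_eqb := he
    computable_add := hf
    computable_mul := hg }⟩

/-! ### Matrix computations on names, with entries stored row by row. -/

namespace NameOps

variable {K : Type*} [Field K] {ν : ℕ → K} (O : NameOps ν)

/-- The sum of a list of names. -/
def sum (l : List ℕ) : ℕ :=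
  l.foldl O.add O.zero

/-- The product of two `d × d` matrices, which are given by the lists of their entries. -/
def matMul (d : ℕ) (A B : List ℕ) : List ℕ :=
  (List.range (d * d)).map fun k => O.sum ((List.range d).map fun j =>
    O.mul (A.getD (k / d * d + j) O.zero) (B.getD (j * d + k % d) O.zero))

/-- The identity matrix. -/
def matOne (d : ℕ) : List ℕ :=
  (List.range (d * d)).map fun k => bif decide (k / d = k % d) then O.one else O.zero

/-- The matrix `c • A + B`. -/
def matSMulAdd (d c : ℕ) (A B : List ℕ) : List ℕ :=
  (List.range (d * d)).map fun k =>
    O.add (O.mul c (A.getD k O.zero)) (B.getD k O.zero)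

/-- Equality of matrices. -/
def matEq (d : ℕ) (A B : List ℕ) : Bool :=
  (List.range (d * d)).all fun k => O.eqb (A.getD k O.zero) (B.getD k O.zero)

/-- Powers of a matrix. -/
def matPow (d : ℕ) (A : List ℕ) (m : ℕ) : List ℕ :=
  Nat.rec (O.matOne d) (fun _ M => O.matMul d M A) m

variable {n : ℕ}

/-- The value of the monomial with exponents `s` at the matrices `X i` with inverses `Y i`. -/
def matMonomial (d : ℕ) (X Y : Fin n → List ℕ) (s : Fin n → ℤ) : List ℕ :=
  (List.finRange n).foldl (fun M i => O.matMul d M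
    (O.matMul d (O.matPow d (X i) (s i).toNat) (O.matPow d (Y i) (-s i).toNat))) (O.matOne d)

/-- The value of a Laurent polynomial at the matrices `X i` with inverses `Y i`. -/
def matEval (d : ℕ) (X Y : Fin n → List ℕ) (c : PosynomialCode ℤ n) : List ℕ :=
  c.foldl (fun M t => O.matSMulAdd d t.1 (O.matMonomial d X Y t.2) M) []

/-- The matrices `X i` commute and have the inverses `Y i`. -/
def matCommInv (d : ℕ) (X Y : Fin n → List ℕ) : Bool :=
  ((List.finRange n).all fun i => O.matEq d (O.matMul d (X i) (Y i)) (O.matOne d)) &&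
  (List.finRange n).all fun i => (List.finRange n).all fun j =>
    O.matEq d (O.matMul d (X i) (X j)) (O.matMul d (X j) (X i))

/-- The commuting invertible `d × d` matrices `X i` are a common zero of the generators, but not of
the last polynomial. -/
def separates (fs : List (PosynomialCode ℤ n)) (g : PosynomialCode ℤ n) (d : ℕ)
    (X Y : Fin n → List ℕ) : Bool :=
  O.matCommInv d X Y &&
  ((fs.all fun c => O.matEq d (O.matEval d X Y c) []) && !O.matEq d (O.matEval d X Y g) [])

section Computable

variable {α : Type*} [Primcodable α] {d : α → ℕ} {A B : α → List ℕ}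

theorem computable_sum {f : α → List ℕ} (hf : Computable f) :
    Computable fun a => O.sum (f a) :=
  Computable.list_foldl hf (Computable.const _)
    (O.computable_add.comp (Computable.fst.comp .snd) (Computable.snd.comp .snd))

theorem computable_matMul (hd : Computable d) (hA : Computable A) (hB : Computable B) :
    Computable fun a => O.matMul (d a) (A a) (B a) := by
  refine Computable.list_map
    (Primrec.list_range.to_comp.comp (Primrec.nat_mul.to_comp.comp hd hd)) ?_
  refine O.computable_sum (Computable.list_map (f := fun p : α × ℕ => List.range (d p.1))
    (g := fun p j => O.mul ((A p.1).getD (p.2 / d p.1 * d p.1 + j) O.zero)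
      ((B p.1).getD (j * d p.1 + p.2 % d p.1) O.zero))
    (Primrec.list_range.to_comp.comp (hd.comp .fst)) ?_)
  have hd' : Computable fun q : (α × ℕ) × ℕ => d q.1.1 := hd.comp (Computable.fst.comp .fst)
  have hk : Computable fun q : (α × ℕ) × ℕ => q.1.2 := Computable.snd.comp .fst
  have hj : Computable fun q : (α × ℕ) × ℕ => q.2 := Computable.snd
  refine O.computable_mul.comp (Computable.list_getD _ (hA.comp (Computable.fst.comp .fst)) ?_)
    (Computable.list_getD _ (hB.comp (Computable.fst.comp .fst)) ?_)
  · exact Primrec.nat_add.to_comp.comp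
      (Primrec.nat_mul.to_comp.comp (Primrec.nat_div.to_comp.comp hk hd') hd') hj
  · exact Primrec.nat_add.to_comp.comp (Primrec.nat_mul.to_comp.comp hj hd')
      (Primrec.nat_mod.to_comp.comp hk hd')

theorem computable_matOne (hd : Computable d) : Computable fun a => O.matOne (d a) := by
  refine Computable.list_map
    (Primrec.list_range.to_comp.comp (Primrec.nat_mul.to_comp.comp hd hd)) ?_
  have hd' : Computable fun q : α × ℕ => d q.1 := hd.comp .fst
  exact Computable.cond
    (Primrec.eq.decide.to_comp.comp (Primrec.nat_div.to_comp.comp .snd hd')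
      (Primrec.nat_mod.to_comp.comp .snd hd'))
    (Computable.const _) (Computable.const _)

theorem computable_matSMulAdd {c : α → ℕ} (hd : Computable d) (hc : Computable c)
    (hA : Computable A) (hB : Computable B) :
    Computable fun a => O.matSMulAdd (d a) (c a) (A a) (B a) := by
  refine Computable.list_map
    (Primrec.list_range.to_comp.comp (Primrec.nat_mul.to_comp.comp hd hd)) ?_
  exact O.computable_add.comp
    (O.computable_mul.comp (hc.comp .fst) (Computable.list_getD _ (hA.comp .fst) .snd))
    (Computable.list_getD _ (hB.comp .fst) .snd)

theorem computable_matEq (hd : Computable d) (hA : Computable A) (hB : Computable B) :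
    Computable fun a => O.matEq (d a) (A a) (B a) := by
  refine Computable.list_all
    (Primrec.list_range.to_comp.comp (Primrec.nat_mul.to_comp.comp hd hd)) ?_
  exact O.computable_eqb.comp (Computable.list_getD _ (hA.comp .fst) .snd)
    (Computable.list_getD _ (hB.comp .fst) .snd)

theorem computable_matPow {m : α → ℕ} (hd : Computable d) (hA : Computable A)
    (hm : Computable m) : Computable fun a => O.matPow (d a) (A a) (m a) := by
  refine Computable.nat_rec hm (O.computable_matOne hd)
    (h := fun a p => O.matMul (d a) p.2 (A a)) ?_
  exact O.computable_matMul (hd.comp .fst) (Computable.snd.comp .snd) (hA.comp .fst)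

variable {X Y : α → Fin n → List ℕ}

theorem computable_matMonomial {s : α → Fin n → ℤ} (hd : Computable d) (hX : Computable X)
    (hY : Computable Y) (hs : Computable s) :
    Computable fun a => O.matMonomial (d a) (X a) (Y a) (s a) := by
  refine Computable.list_foldl (Computable.const _) (O.computable_matOne hd)
    (h := fun a M i => O.matMul (d a) M (O.matMul (d a) (O.matPow (d a) (X a i) (s a i).toNat)
      (O.matPow (d a) (Y a i) (-s a i).toNat))) ?_
  have hd' : Computable fun p : α × List ℕ × Fin n => d p.1 := hd.comp .fst
  have hi : Computable fun p : α × List ℕ × Fin n => p.2.2 := Computable.snd.comp .snd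
  have hs' : Computable fun p : α × List ℕ × Fin n => s p.1 p.2.2 :=
    Computable.fin_app.comp (hs.comp .fst) hi
  refine O.computable_matMul hd' (Computable.fst.comp .snd) (O.computable_matMul hd' ?_ ?_)
  · exact O.computable_matPow hd' (Computable.fin_app.comp (hX.comp .fst) hi)
      (Primrec.int_toNat.to_comp.comp hs')
  · exact O.computable_matPow hd' (Computable.fin_app.comp (hY.comp .fst) hi)
      (Primrec.int_neg_toNat.to_comp.comp hs')

theorem computable_matEval {c : α → PosynomialCode ℤ n} (hd : Computable d)
    (hX : Computable X) (hY : Computable Y) (hc : Computable c) :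
    Computable fun a => O.matEval (d a) (X a) (Y a) (c a) := by
  refine Computable.list_foldl hc (Computable.const [])
    (h := fun a M t => O.matSMulAdd (d a) t.1 (O.matMonomial (d a) (X a) (Y a) t.2) M) ?_
  have ht : Computable fun p : α × List ℕ × ℕ × (Fin n → ℤ) => p.2.2 := Computable.snd.comp .snd
  exact O.computable_matSMulAdd (hd.comp .fst) (Computable.fst.comp ht)
    (O.computable_matMonomial (hd.comp .fst) (hX.comp .fst) (hY.comp .fst)
      (Computable.snd.comp ht)) (Computable.fst.comp .snd)

theorem computable_matCommInv (hd : Computable d) (hX : Computable X) (hY : Computable Y) :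
    Computable fun a => O.matCommInv (d a) (X a) (Y a) := by
  refine Computable.bool_and
    (Computable.list_all (Computable.const _)
      (g := fun a i => O.matEq (d a) (O.matMul (d a) (X a i) (Y a i)) (O.matOne (d a))) ?_)
    (Computable.list_all (Computable.const _)
      (g := fun a i => (List.finRange n).all fun j =>
        O.matEq (d a) (O.matMul (d a) (X a i) (X a j)) (O.matMul (d a) (X a j) (X a i))) ?_)
  · have hd' : Computable fun p : α × Fin n => d p.1 := hd.comp .fst
    exact O.computable_matEq hd' (O.computable_matMul hd'
      (Computable.fin_app.comp (hX.comp .fst) .snd) (Computable.fin_app.comp (hY.comp .fst) .snd))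
      (O.computable_matOne hd')
  · refine Computable.list_all (Computable.const _)
      (g := fun (p : α × Fin n) j => O.matEq (d p.1) (O.matMul (d p.1) (X p.1 p.2) (X p.1 j))
        (O.matMul (d p.1) (X p.1 j) (X p.1 p.2))) ?_
    have hd' : Computable fun q : (α × Fin n) × Fin n => d q.1.1 :=
      hd.comp (Computable.fst.comp .fst)
    have hX' : Computable fun q : (α × Fin n) × Fin n => X q.1.1 :=
      hX.comp (Computable.fst.comp .fst)
    have hi : Computable fun q : (α × Fin n) × Fin n => X q.1.1 q.1.2 :=
      Computable.fin_app.comp hX' (Computable.snd.comp .fst)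
    have hj : Computable fun q : (α × Fin n) × Fin n => X q.1.1 q.2 :=
      Computable.fin_app.comp hX' .snd
    exact O.computable_matEq hd' (O.computable_matMul hd' hi hj) (O.computable_matMul hd' hj hi)

theorem computable_separates {fs : α → List (PosynomialCode ℤ n)} {g : α → PosynomialCode ℤ n}
    (hfs : Computable fs) (hg : Computable g) (hd : Computable d) (hX : Computable X)
    (hY : Computable Y) :
    Computable fun a => O.separates (fs a) (g a) (d a) (X a) (Y a) := by
  refine Computable.bool_and (O.computable_matCommInv hd hX hY) (Computable.bool_and
    (Computable.list_all hfs
      (g := fun a c => O.matEq (d a) (O.matEval (d a) (X a) (Y a) c) []) ?_)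
    (Primrec.not.to_comp.comp ?_))
  · exact O.computable_matEq (hd.comp .fst) (O.computable_matEval (hd.comp .fst) (hX.comp .fst)
      (hY.comp .fst) .snd) (Computable.const _)
  · exact O.computable_matEq hd (O.computable_matEval hd hX hY hg) (Computable.const _)

end Computable

end NameOps

/-! ### Separation of an element from an ideal by finite-dimensional representations. -/

/-- An element of a finitely generated commutative algebra over a field that is outside an ideal
stays nonzero in some quotient of finite dimension over the field in which the ideal vanishes. -/
theorem exists_finite_quotient_notMem {K R : Type*} [Field K] [CommRing R] [Algebra K R]
    [Algebra.FiniteType K R] {I : Ideal R} {g : R} (hg : g ∉ I) :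
    ∃ J : Ideal R, I ≤ J ∧ g ∉ J ∧ Module.Finite K (R ⧸ J) := by
  have : IsNoetherianRing R := Algebra.FiniteType.isNoetherianRing K R
  let N : Ideal R := I.colon {g}
  have hN : N ≠ ⊤ := fun h => hg (by
    have : (1 : R) ∈ N := h ▸ Submodule.mem_top
    simpa [N, Submodule.mem_colon_singleton] using this)
  obtain ⟨m, hm, hNm⟩ := Ideal.exists_le_maximal N hN
  -- Otherwise the class of `g` lies in every `m ^ i • (R ⧸ I)`. Krull's theorem then gives `r ∈ m`
  -- fixing this class, so `1 - r ∈ N ≤ m` and hence `1 ∈ m`.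
  obtain ⟨k, hk⟩ : ∃ k, g ∉ I ⊔ m ^ k := by
    by_contra! h
    have h1 : (Ideal.Quotient.mk I g : R ⧸ I) ∈ (⨅ i : ℕ, m ^ i • ⊤ : Submodule R (R ⧸ I)) := by
      rw [Submodule.mem_iInf]
      intro i
      obtain ⟨a, ha, b, hb, hab⟩ := Submodule.mem_sup.1 (h i)
      have : (Ideal.Quotient.mk I g : R ⧸ I) = b • (1 : R ⧸ I) := by
        rw [Algebra.smul_def, mul_one, Ideal.Quotient.algebraMap_eq, ← hab, map_add,
          Ideal.Quotient.eq_zero_iff_mem.2 ha, zero_add]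
      rw [this]
      exact Submodule.smul_mem_smul hb Submodule.mem_top
    obtain ⟨⟨r, hr⟩, hrg⟩ := (m.mem_iInf_smul_pow_eq_bot_iff _).1 h1
    have h2 : 1 - r ∈ N := by
      rw [Submodule.mem_colon_singleton, smul_eq_mul, sub_mul, one_mul,
        ← Ideal.Quotient.mk_eq_mk_iff_sub_mem]
      rw [map_mul]
      exact hrg.symm
    exact hm.ne_top ((Ideal.eq_top_iff_one _).2 (by simpa using add_mem (hNm h2) hr))
  refine ⟨I ⊔ m ^ k, le_sup_left, hk, ?_⟩
  -- It remains to see that all primes of the quotient are maximal: the preimage of such a prime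
  -- contains `m ^ k`, hence `m`, hence equals `m`.
  rw [Module.finite_iff_krullDimLE_zero, Ring.krullDimLE_zero_iff]
  intro p hp
  have hmp : m ≤ p.comap (Ideal.Quotient.mk (I ⊔ m ^ k)) := by
    refine Ideal.IsPrime.le_of_pow_le (n := k) fun x hx => ?_
    rw [Ideal.mem_comap, Ideal.Quotient.eq_zero_iff_mem.2 (Ideal.mem_sup_right hx)]
    exact p.zero_mem
  have hmax := hm.eq_of_le (Ideal.IsPrime.ne_top inferInstance) hmp
  have : (p.comap (Ideal.Quotient.mk (I ⊔ m ^ k))).IsMaximal := hmax ▸ hm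
  rcases Ideal.map_eq_top_or_isMaximal_of_surjective
      (Ideal.Quotient.mk (I ⊔ m ^ k)) Ideal.Quotient.mk_surjective this with h | h
  · rw [Ideal.map_comap_of_surjective _ Ideal.Quotient.mk_surjective] at h
    exact absurd h hp.ne_top
  · rwa [Ideal.map_comap_of_surjective _ Ideal.Quotient.mk_surjective] at h

/-- Separation by matrices: an element outside an ideal of a finitely generated commutative algebra
over a field has a nonzero image in some matrix representation that kills the ideal. -/
theorem exists_matrix_algHom_of_notMem {K R : Type*} [Field K] [CommRing R] [Algebra K R]
    [Algebra.FiniteType K R] {I : Ideal R} {g : R} (hg : g ∉ I) :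
    ∃ (d : ℕ) (ψ : R →ₐ[K] Matrix (Fin d) (Fin d) K), (∀ f ∈ I, ψ f = 0) ∧ ψ g ≠ 0 := by
  obtain ⟨J, hIJ, hgJ, hfin⟩ := exists_finite_quotient_notMem (K := K) hg
  let b := Module.finBasis K (R ⧸ J)
  -- The regular representation of the quotient is faithful because the quotient has a unit.
  refine ⟨_, (Algebra.leftMulMatrix b).comp (Ideal.Quotient.mkₐ K J), fun f hf => ?_, fun h => ?_⟩
  · simp [Ideal.Quotient.eq_zero_iff_mem.2 (hIJ hf)]
  · refine hgJ (Ideal.Quotient.eq_zero_iff_mem.1 (Algebra.leftMulMatrix_injective b ?_))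
    simpa using h

/-! ### Evaluation of Laurent polynomials at commuting units of a possibly noncommutative algebra.
-/

section LaurentMonomial

variable {n : ℕ}

/-- The product of the powers `x i ^ s i`, where `y i` is the inverse of `x i`. -/
def laurentMonomial {M : Type*} [Monoid M] (x y : Fin n → M) (s : Fin n → ℤ) : M :=
  ((List.finRange n).map fun i => x i ^ (s i).toNat * y i ^ (-s i).toNat).prod

/-- At least one of the two exponents is zero. Natural powers of an element and its inverse thus
replace integer powers, which matches the matrix algorithm. -/
theorem Units.pow_toNat_mul_pow_toNat {M : Type*} [Monoid M] (u : Mˣ) (z : ℤ) :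
    (u : M) ^ z.toNat * (↑u⁻¹ : M) ^ (-z).toNat = ↑(u ^ z) := by
  cases z with
  | ofNat m => simp
  | negSucc m => simp

theorem List.prod_map_mul_of_commute {ι M : Type*} [Monoid M] (l : List ι) (f g : ι → M)
    (h : ∀ i j, Commute (f i) (g j)) :
    (l.map fun i => f i * g i).prod = (l.map f).prod * (l.map g).prod := by
  induction l with
  | nil => simp
  | cons a l ih =>
    have hc : Commute (l.map f).prod (g a) := by
      refine Commute.list_prod_left _ _ fun x hx => ?_
      obtain ⟨i, -, rfl⟩ := List.mem_map.1 hx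
      exact h i a
    simp only [List.map_cons, List.prod_cons, ih]
    rw [mul_assoc, ← mul_assoc (g a), ← hc.eq, mul_assoc, mul_assoc]

/-- The homomorphism from `ℤⁿ` given by commuting invertible elements. -/
def laurentMonomialHom {M : Type*} [Monoid M] (u : Fin n → Mˣ)
    (h : ∀ i j, Commute (u i) (u j)) : Multiplicative (Fin n → ℤ) →* M where
  toFun s := laurentMonomial (fun i => (u i : M)) (fun i => (↑(u i)⁻¹ : M)) s.toAdd
  map_one' := by simp [laurentMonomial]
  map_mul' s t := by
    simp only [laurentMonomial, Units.pow_toNat_mul_pow_toNat]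
    rw [← List.prod_map_mul_of_commute]
    · simp [zpow_add]
    · intro i j
      exact Units.ext_iff.1 (((h i j).zpow_zpow _ _).eq)

variable {K : Type*} [Field K]

/-- Evaluation of Laurent polynomials at commuting invertible elements of an algebra. -/
noncomputable def laurentEval {M : Type*} [Ring M] [Algebra K M] (u : Fin n → Mˣ)
    (h : ∀ i j, Commute (u i) (u j)) : PosynomialRing K ℤ n →ₐ[K] M :=
  AddMonoidAlgebra.lift K M _ (laurentMonomialHom u h)

theorem laurentEval_single {M : Type*} [Ring M] [Algebra K M] (u : Fin n → Mˣ)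
    (h : ∀ i j, Commute (u i) (u j)) (s : Fin n → ℤ) (c : K) :
    laurentEval u h (AddMonoidAlgebra.single s c) =
      c • laurentMonomial (fun i => (u i : M)) (fun i => (↑(u i)⁻¹ : M)) s := by
  rw [laurentEval, AddMonoidAlgebra.lift_single]
  rfl

theorem AddMonoidAlgebra.laurentMonomial_single (s : Fin n → ℤ) :
    laurentMonomial (fun i => (single (Pi.single i 1) 1 : PosynomialRing K ℤ n))
      (fun i => single (-Pi.single i 1) 1) s = single s 1 := by
  have h : ∀ i, ((single (Pi.single i 1) 1 : PosynomialRing K ℤ n) ^ (s i).toNat *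
      single (-Pi.single i 1) 1 ^ (-s i).toNat) = of K _ (.ofAdd (Pi.single i (s i))) := by
    intro i
    rw [single_pow, single_pow, single_mul_single, of_apply]
    simp only [one_pow, mul_one, toAdd_ofAdd]
    congr 1
    ext j
    by_cases hj : j = i
    · subst hj
      simp
      omega
    · simp [hj]
  simp only [laurentMonomial, h]
  rw [← List.ofFn_eq_map, List.prod_ofFn, ← map_prod, ← ofAdd_sum, Finset.univ_sum_single,
    of_apply, toAdd_ofAdd]

/-- A representation is determined by the images of the variables and their inverses, which is why
finitely many matrices encode it. -/
theorem AlgHom.map_single_eq_laurentMonomial {M : Type*} [Ring M] [Algebra K M]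
    (ψ : PosynomialRing K ℤ n →ₐ[K] M) (s : Fin n → ℤ) (c : K) :
    ψ (AddMonoidAlgebra.single s c) =
      c • laurentMonomial (fun i => ψ (AddMonoidAlgebra.single (Pi.single i 1) 1))
        (fun i => ψ (AddMonoidAlgebra.single (-Pi.single i 1) 1)) s := by
  have : (AddMonoidAlgebra.single s c : PosynomialRing K ℤ n) =
      c • AddMonoidAlgebra.single s 1 := by
    rw [AddMonoidAlgebra.smul_single, smul_eq_mul, mul_one]
  rw [this, map_smul, ← AddMonoidAlgebra.laurentMonomial_single]
  simp only [laurentMonomial, map_list_prod, List.map_map, Function.comp_def, map_mul, map_pow]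

end LaurentMonomial

/-! ### Correctness of the matrix test: the certificate of non-membership. -/

namespace NameOps

variable {K : Type*} [Field K] {ν : ℕ → K} (O : NameOps ν)

theorem val_sum (l : List ℕ) : ν (O.sum l) = (l.map ν).sum := by
  induction l using List.reverseRecOn with
  | nil => exact O.val_zero
  | append_singleton l a ih =>
    have : O.sum (l ++ [a]) = O.add (O.sum l) a := by simp [sum]
    simp [this, O.val_add, ih]

/-- The matrix described by a list of names of its entries. -/
def toMatrix (d : ℕ) (A : List ℕ) : Matrix (Fin d) (Fin d) K :=
  Matrix.of fun i j => ν (A.getD (i * d + j) O.zero)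

theorem entry_lt {d : ℕ} (i j : Fin d) : (i * d + j : ℕ) < d * d := by
  have h1 := i.2
  have h2 := j.2
  nlinarith

theorem getD_map_range {d : ℕ} (F : ℕ → ℕ) (z : ℕ) (i j : Fin d) :
    ((List.range (d * d)).map F).getD (i * d + j) z = F (i * d + j) := by
  simp [List.getD_eq_getElem?_getD, entry_lt i j]

theorem entry_div {d : ℕ} (i j : Fin d) : (i * d + j : ℕ) / d = i := by
  rw [mul_comm, Nat.mul_add_div (Fin.pos i), Nat.div_eq_of_lt j.2, add_zero]

theorem entry_mod {d : ℕ} (i j : Fin d) : (i * d + j : ℕ) % d = j := by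
  rw [mul_comm, Nat.mul_add_mod, Nat.mod_eq_of_lt j.2]

/-- Entries missing from the list default to `O.zero`; hence `[]` serves as the zero matrix in every
dimension. -/
theorem toMatrix_nil (d : ℕ) : O.toMatrix d [] = 0 := by
  ext i j
  simp [toMatrix, O.val_zero]

theorem toMatrix_matMul (d : ℕ) (A B : List ℕ) :
    O.toMatrix d (O.matMul d A B) = O.toMatrix d A * O.toMatrix d B := by
  ext i j
  simp only [toMatrix, Matrix.of_apply, Matrix.mul_apply, matMul, getD_map_range, val_sum,
    entry_div, entry_mod, List.map_map, Function.comp_def, O.val_mul]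
  rw [Fin.sum_univ_eq_sum_range
    (fun k => ν (A.getD (i * d + k) O.zero) * ν (B.getD (k * d + j) O.zero)) d]
  rfl

theorem toMatrix_matOne (d : ℕ) : O.toMatrix d (O.matOne d) = 1 := by
  ext i j
  simp only [toMatrix, Matrix.of_apply, matOne, getD_map_range, entry_div, entry_mod,
    Matrix.one_apply, Fin.val_inj]
  by_cases h : i = j <;> simp [h, O.val_one, O.val_zero]

theorem toMatrix_matSMulAdd (d c : ℕ) (A B : List ℕ) :
    O.toMatrix d (O.matSMulAdd d c A B) = ν c • O.toMatrix d A + O.toMatrix d B := by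
  ext i j
  simp only [toMatrix, matSMulAdd, Matrix.of_apply, Matrix.add_apply, Matrix.smul_apply,
    getD_map_range, O.val_add, O.val_mul, smul_eq_mul]

theorem matEq_iff (d : ℕ) (A B : List ℕ) :
    O.matEq d A B = true ↔ O.toMatrix d A = O.toMatrix d B := by
  simp only [matEq, List.all_eq_true, List.mem_range, O.eqb_iff]
  constructor
  · intro h
    ext i j
    exact h _ (entry_lt i j)
  · intro h k hk
    have hd : 0 < d := Nat.pos_of_ne_zero fun h0 => by simp [h0] at hk
    have := congrFun (congrFun h ⟨k / d, Nat.div_lt_of_lt_mul hk⟩) ⟨k % d, Nat.mod_lt _ hd⟩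
    simpa [toMatrix, Nat.div_add_mod'] using this

theorem toMatrix_matPow (d : ℕ) (A : List ℕ) (m : ℕ) :
    O.toMatrix d (O.matPow d A m) = O.toMatrix d A ^ m := by
  induction m with
  | zero => simp [matPow, toMatrix_matOne]
  | succ m ih =>
    rw [pow_succ, ← ih, ← toMatrix_matMul]
    rfl

theorem exists_toMatrix_eq (hν : Function.Surjective ν) {d : ℕ} (A : Matrix (Fin d) (Fin d) K) :
    ∃ L, O.toMatrix d L = A := by
  choose r hr using hν
  rcases Nat.eq_zero_or_pos d with rfl | hd
  · exact ⟨[], by ext i; exact i.elim0⟩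
  -- The reduction `% d` of the row index only supplies the bound for `Fin d`; it changes nothing
  -- for `k < d * d`.
  refine ⟨(List.range (d * d)).map fun k =>
    r (A ⟨k / d % d, Nat.mod_lt _ hd⟩ ⟨k % d, Nat.mod_lt _ hd⟩), ?_⟩
  ext i j
  simp only [toMatrix, Matrix.of_apply, getD_map_range, hr, entry_div, entry_mod]
  congr 1
  exact Fin.ext (Nat.mod_eq_of_lt i.2)

variable {n : ℕ}

theorem toMatrix_matMonomial (d : ℕ) (X Y : Fin n → List ℕ) (s : Fin n → ℤ) :
    O.toMatrix d (O.matMonomial d X Y s) =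
      laurentMonomial (fun i => O.toMatrix d (X i)) (fun i => O.toMatrix d (Y i)) s := by
  rw [matMonomial, laurentMonomial]
  induction List.finRange n using List.reverseRecOn with
  | nil => simp [toMatrix_matOne]
  | append_singleton l i ih =>
    simp [List.foldl_append, toMatrix_matMul, toMatrix_matPow, ih]

theorem toMatrix_matEval (d : ℕ) (X Y : Fin n → List ℕ) (c : PosynomialCode ℤ n) :
    O.toMatrix d (O.matEval d X Y c) = (c.map fun t => ν t.1 •
      laurentMonomial (fun i => O.toMatrix d (X i)) (fun i => O.toMatrix d (Y i)) t.2).sum := by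
  rw [matEval]
  induction c using List.reverseRecOn with
  | nil => simp [toMatrix_nil]
  | append_singleton l t ih =>
    simp [List.foldl_append, toMatrix_matSMulAdd, toMatrix_matMonomial, ih, add_comm]

theorem toMatrix_matEval_eq_algHom {d : ℕ} {X Y : Fin n → List ℕ}
    (ψ : PosynomialRing K ℤ n →ₐ[K] Matrix (Fin d) (Fin d) K)
    (h : ∀ s c, ψ (AddMonoidAlgebra.single s c) = c •
      laurentMonomial (fun i => O.toMatrix d (X i)) (fun i => O.toMatrix d (Y i)) s)
    (c : PosynomialCode ℤ n) : O.toMatrix d (O.matEval d X Y c) = ψ (laurentOfCode ν c) := by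
  rw [toMatrix_matEval, laurentOfCode, map_list_sum, List.map_map]
  simp [Function.comp_def, h]

theorem matCommInv_iff (d : ℕ) (X Y : Fin n → List ℕ) :
    O.matCommInv d X Y = true ↔
      (∀ i, O.toMatrix d (X i) * O.toMatrix d (Y i) = 1) ∧
      ∀ i j, Commute (O.toMatrix d (X i)) (O.toMatrix d (X j)) := by
  simp [matCommInv, matEq_iff, toMatrix_matMul, toMatrix_matOne, Commute, SemiconjBy]

theorem separates_iff (fs : List (PosynomialCode ℤ n)) (g : PosynomialCode ℤ n) (d : ℕ)
    (X Y : Fin n → List ℕ) :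
    O.separates fs g d X Y = true ↔ O.matCommInv d X Y = true ∧
      (∀ c ∈ fs, O.toMatrix d (O.matEval d X Y c) = 0) ∧
      O.toMatrix d (O.matEval d X Y g) ≠ 0 := by
  simp only [separates, Bool.and_eq_true, Bool.not_eq_true', List.all_eq_true, matEq_iff,
    toMatrix_nil, ← Bool.not_eq_true, ne_eq]

/-- Matrices passing the test define an evaluation homomorphism whose kernel contains the ideal but
not `g`. Conversely, the images of the variables and their inverses under a separating
representation pass the test. -/
theorem exists_separates_iff (hν : Function.Surjective ν) (fs : List (PosynomialCode ℤ n))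
    (g : PosynomialCode ℤ n) :
    (∃ w : ℕ × (Fin n → List ℕ) × (Fin n → List ℕ),
      O.separates fs g w.1 w.2.1 w.2.2 = true) ↔
      laurentOfCode ν g ∉ Ideal.span {f | ∃ c ∈ fs, laurentOfCode ν c = f} := by
  constructor
  · rintro ⟨⟨d, X, Y⟩, hw⟩ hg
    obtain ⟨hXY, hfs, hgn⟩ := (O.separates_iff _ _ _ _ _).1 hw
    obtain ⟨hinv, hcomm⟩ := (O.matCommInv_iff _ _ _).1 hXY
    -- A one-sided inverse of a square matrix is two-sided, so testing one product is enough.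
    let u : Fin n → (Matrix (Fin d) (Fin d) K)ˣ := fun i =>
      ⟨O.toMatrix d (X i), O.toMatrix d (Y i), hinv i, mul_eq_one_comm.1 (hinv i)⟩
    have hu : ∀ i j, Commute (u i) (u j) := fun i j => Units.ext (hcomm i j)
    have key := O.toMatrix_matEval_eq_algHom (X := X) (Y := Y) (laurentEval u hu)
      (laurentEval_single u hu)
    have hker : Ideal.span {f | ∃ c ∈ fs, laurentOfCode ν c = f} ≤
        RingHom.ker (laurentEval (K := K) u hu) := by
      rw [Ideal.span_le]
      rintro _ ⟨c, hc, rfl⟩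
      exact (key c).symm.trans (hfs c hc)
    exact hgn ((key g).trans (hker hg))
  · intro hg
    obtain ⟨d, ψ, hψ, hψg⟩ := exists_matrix_algHom_of_notMem (K := K) hg
    choose X hX using fun i : Fin n =>
      O.exists_toMatrix_eq hν (ψ (AddMonoidAlgebra.single (Pi.single i 1) 1))
    choose Y hY using fun i : Fin n =>
      O.exists_toMatrix_eq hν (ψ (AddMonoidAlgebra.single (-Pi.single i 1) 1))
    have key := O.toMatrix_matEval_eq_algHom (X := X) (Y := Y) ψ fun s c => by
      simp only [hX, hY]
      exact ψ.map_single_eq_laurentMonomial s c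
    refine ⟨⟨d, X, Y⟩, (O.separates_iff _ _ _ _ _).2 ⟨(O.matCommInv_iff _ _ _).2 ⟨?_, ?_⟩, ?_, ?_⟩⟩
    · intro i
      rw [hX, hY, ← map_mul, AddMonoidAlgebra.single_mul_single, add_neg_cancel, mul_one]
      exact map_one ψ
    · intro i j
      rw [hX, hX]
      exact (Commute.all _ _).map ψ
    · intro c hc
      rw [key]
      exact hψ _ (Ideal.subset_span ⟨c, hc, rfl⟩)
    · rwa [key]

end NameOps

/-! ### Search for cofactors: the certificate of membership. -/

namespace NameOps

variable {K : Type*} [Field K] {ν : ℕ → K} (O : NameOps ν) {n : ℕ}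

/-- The coefficient of the monomial with exponents `s`. -/
def coeffName (c : PosynomialCode ℤ n) (s : Fin n → ℤ) : ℕ :=
  c.foldl (fun r t => bif decide (t.2 = s) then O.add r t.1 else r) O.zero

/-- The test whether a list of terms describes zero. -/
def codeEqZero (c : PosynomialCode ℤ n) : Bool :=
  c.all fun t => O.eqb (O.coeffName c t.2) O.zero

/-- The product of a term and a Laurent polynomial. -/
def termMul (t : ℕ × (Fin n → ℤ)) (c : PosynomialCode ℤ n) : PosynomialCode ℤ n :=
  c.map fun t' => (O.mul t.1 t'.1, fun i => t.2 i + t'.2 i)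

/-- The combination of generators whose cofactors are given by a list of terms together with the
indices of the generators. -/
def combination (fs : List (PosynomialCode ℤ n)) (w : List (ℕ × ℕ × (Fin n → ℤ))) :
    PosynomialCode ℤ n :=
  w.flatMap fun q => O.termMul q.2 (fs.getD q.1 [])

/-- The test whether a list of cofactors represents a Laurent polynomial. -/
def represents (fs : List (PosynomialCode ℤ n)) (g : PosynomialCode ℤ n)
    (w : List (ℕ × ℕ × (Fin n → ℤ))) : Bool :=
  O.codeEqZero (O.combination fs w ++ O.termMul (O.negOne, 0) g)

section Computable

variable {α : Type*} [Primcodable α]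

theorem computable_coeffName {c : α → PosynomialCode ℤ n} {s : α → Fin n → ℤ}
    (hc : Computable c) (hs : Computable s) : Computable fun a => O.coeffName (c a) (s a) := by
  have ht : Computable fun p : α × ℕ × ℕ × (Fin n → ℤ) => p.2.2 := Computable.snd.comp .snd
  have hr : Computable fun p : α × ℕ × ℕ × (Fin n → ℤ) => p.2.1 := Computable.fst.comp .snd
  have heq : Computable₂ fun s s' : Fin n → ℤ => decide (s = s') := Primrec.eq.decide.to_comp
  have hst : Computable fun p : α × ℕ × ℕ × (Fin n → ℤ) => decide (p.2.2.2 = s p.1) :=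
    heq.comp (Computable.snd.comp ht) (hs.comp .fst)
  have := Computable.list_foldl (g := fun _ => O.zero)
    (h := fun a r (t : ℕ × (Fin n → ℤ)) => bif decide (t.2 = s a) then O.add r t.1 else r)
    hc (Computable.const _)
    (Computable.cond hst (O.computable_add.comp hr (Computable.fst.comp ht)) hr)
  exact this

theorem computable_codeEqZero {c : α → PosynomialCode ℤ n} (hc : Computable c) :
    Computable fun a => O.codeEqZero (c a) :=
  Computable.list_all hc (O.computable_eqb.comp
    (O.computable_coeffName (hc.comp .fst) (Computable.snd.comp .snd)) (Computable.const _))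

theorem computable_termMul {t : α → ℕ × (Fin n → ℤ)} {c : α → PosynomialCode ℤ n}
    (ht : Computable t) (hc : Computable c) : Computable fun a => O.termMul (t a) (c a) := by
  refine Computable.list_map hc
    (g := fun a t' => (O.mul (t a).1 t'.1, fun i => (t a).2 i + t'.2 i)) ?_
  have hadd : Primrec fun p : (Fin n → ℤ) × (Fin n → ℤ) => fun i => p.1 i + p.2 i :=
    Primrec.fin_curry.2 (Primrec.int_add.comp
      (Primrec.fin_app.comp (Primrec.fst.comp .fst) .snd)
      (Primrec.fin_app.comp (Primrec.snd.comp .fst) .snd))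
  exact (O.computable_mul.comp (Computable.fst.comp (ht.comp .fst))
    (Computable.fst.comp .snd)).pair
    (hadd.to_comp.comp ((Computable.snd.comp (ht.comp .fst)).pair (Computable.snd.comp .snd)))

theorem computable_represents {fs : α → List (PosynomialCode ℤ n)} {g : α → PosynomialCode ℤ n}
    {w : α → List (ℕ × ℕ × (Fin n → ℤ))} (hfs : Computable fs) (hg : Computable g)
    (hw : Computable w) : Computable fun a => O.represents (fs a) (g a) (w a) := by
  refine O.computable_codeEqZero (Computable.list_append.comp ?_
    (O.computable_termMul (Computable.const _) hg))
  refine Computable.list_flatMap hw (g := fun a q => O.termMul q.2 ((fs a).getD q.1 [])) ?_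
  exact O.computable_termMul (Computable.snd.comp .snd)
    (Computable.list_getD _ (hfs.comp .fst) (Computable.fst.comp .snd))

end Computable

theorem coeff_laurentOfCode (c : PosynomialCode ℤ n) (s : Fin n → ℤ) :
    (laurentOfCode ν c).coeff s = ν (O.coeffName c s) := by
  rw [laurentOfCode, coeffName]
  induction c using List.reverseRecOn with
  | nil => simp [O.val_zero]
  | append_singleton l t ih =>
    by_cases h : t.2 = s
    · simp [List.foldl_append, ih, h, O.val_add]
    · simp [List.foldl_append, ih, h]

/-- Terms with equal exponents may repeat, so collected coefficients are tested. Exponents absent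
from the list have coefficient zero and need no test. -/
theorem codeEqZero_iff (c : PosynomialCode ℤ n) :
    O.codeEqZero c = true ↔ laurentOfCode ν c = 0 := by
  simp only [codeEqZero, List.all_eq_true, O.eqb_iff, ← coeff_laurentOfCode, O.val_zero]
  constructor
  · intro h
    ext s
    by_cases hs : ∃ t ∈ c, t.2 = s
    · obtain ⟨t, ht, rfl⟩ := hs
      simpa using h t ht
    · push Not at hs
      have hz : ∀ l : PosynomialCode ℤ n, (∀ t ∈ l, t.2 ≠ s) → (laurentOfCode ν l).coeff s = 0 := by
        intro l hl
        induction l with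
        | nil => simp [laurentOfCode]
        | cons t l ih =>
          have h1 := hl t List.mem_cons_self
          have h2 := ih fun t' ht' => hl t' (List.mem_cons_of_mem _ ht')
          simp only [laurentOfCode] at h2
          simp [laurentOfCode, h1, h2]
      simpa using hz c hs
  · intro h t _
    simp [h]

theorem laurentOfCode_append (c c' : PosynomialCode ℤ n) :
    laurentOfCode ν (c ++ c') = laurentOfCode ν c + laurentOfCode ν c' := by
  simp [laurentOfCode]

theorem laurentOfCode_termMul (t : ℕ × (Fin n → ℤ)) (c : PosynomialCode ℤ n) :
    laurentOfCode ν (O.termMul t c) =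
      AddMonoidAlgebra.single t.2 (ν t.1) * laurentOfCode ν c := by
  simp only [laurentOfCode, termMul, List.map_map, ← List.sum_map_mul_left, Function.comp_def,
    AddMonoidAlgebra.single_mul_single, O.val_mul]
  rfl

theorem laurentOfCode_combination_mem (fs : List (PosynomialCode ℤ n))
    (w : List (ℕ × ℕ × (Fin n → ℤ))) : laurentOfCode ν (O.combination fs w) ∈
      Ideal.span {f | ∃ c ∈ fs, laurentOfCode ν c = f} := by
  induction w with
  | nil => exact zero_mem _
  | cons q w ih =>
    have : O.combination fs (q :: w) =
      O.termMul q.2 (fs.getD q.1 []) ++ O.combination fs w := rfl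
    rw [this, laurentOfCode_append, laurentOfCode_termMul]
    refine add_mem (Ideal.mul_mem_left _ _ ?_) ih
    by_cases h : q.1 < fs.length
    · refine Ideal.subset_span ⟨_, List.getElem_mem h, ?_⟩
      simp [List.getD_eq_getElem?_getD, h]
    -- An index out of range selects the empty code and contributes zero, so every list `w` is a
    -- legitimate candidate.
    · have : fs.getD q.1 [] = [] := by simp [List.getD_eq_getElem?_getD, not_lt.1 h]
      rw [this]
      exact zero_mem _

theorem exists_laurentOfCode_combination_eq (hν : Function.Surjective ν)
    (fs : List (PosynomialCode ℤ n)) {f : PosynomialRing K ℤ n}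
    (hf : f ∈ Ideal.span {f | ∃ c ∈ fs, laurentOfCode ν c = f}) :
    ∃ w, laurentOfCode ν (O.combination fs w) = f := by
  have hadd : ∀ w w', laurentOfCode ν (O.combination fs (w ++ w')) =
      laurentOfCode ν (O.combination fs w) + laurentOfCode ν (O.combination fs w') := by
    intro w w'
    rw [← laurentOfCode_append, combination, combination, combination, List.flatMap_append]
  induction hf using Submodule.span_induction with
  | mem f hf =>
    obtain ⟨c, hc, rfl⟩ := hf
    obtain ⟨i, hi, rfl⟩ := List.mem_iff_getElem.1 hc
    refine ⟨[(i, O.one, 0)], ?_⟩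
    have : O.combination fs [(i, O.one, 0)] = O.termMul (O.one, 0) fs[i] := by
      simp [combination, List.getD_eq_getElem?_getD, hi]
    rw [this, laurentOfCode_termMul, O.val_one]
    exact one_mul _
  | zero => exact ⟨[], rfl⟩
  | add f g _ _ hf hg =>
    obtain ⟨w, rfl⟩ := hf
    obtain ⟨w', rfl⟩ := hg
    exact ⟨_, hadd w w'⟩
  | smul a f hmem hf =>
    obtain ⟨w, rfl⟩ := hf
    clear hmem
    rw [smul_eq_mul]
    -- A multiplier is a sum of terms: sums become concatenations of cofactor lists, and a single
    -- term is absorbed into every cofactor term.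
    induction a using AddMonoidAlgebra.induction_linear with
    | zero => exact ⟨[], by rw [zero_mul]; rfl⟩
    | add a b ha hb =>
      obtain ⟨u, hu⟩ := ha
      obtain ⟨v, hv⟩ := hb
      exact ⟨u ++ v, by rw [hadd, hu, hv, add_mul]⟩
    | single s c =>
      obtain ⟨r, rfl⟩ := hν c
      refine ⟨w.map fun q => (q.1, O.mul r q.2.1, fun i => s i + q.2.2 i), ?_⟩
      rw [← O.laurentOfCode_termMul (r, s)]
      induction w with
      | nil => rfl
      | cons q w ih =>
        have h1 : ∀ (q : ℕ × ℕ × (Fin n → ℤ)) w, O.combination fs (q :: w) =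
          O.termMul q.2 (fs.getD q.1 []) ++ O.combination fs w := fun _ _ => rfl
        have h2 : ∀ c c' : PosynomialCode ℤ n, O.termMul (r, s) (c ++ c') =
          O.termMul (r, s) c ++ O.termMul (r, s) c' := fun _ _ => List.map_append
        rw [List.map_cons, h1, h1, h2, laurentOfCode_append, laurentOfCode_append, ih,
          laurentOfCode_termMul, laurentOfCode_termMul, laurentOfCode_termMul,
          laurentOfCode_termMul, ← mul_assoc, AddMonoidAlgebra.single_mul_single, O.val_mul]
        rfl

theorem exists_represents_iff (hν : Function.Surjective ν) (fs : List (PosynomialCode ℤ n))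
    (g : PosynomialCode ℤ n) : (∃ w, O.represents fs g w = true) ↔
      laurentOfCode ν g ∈ Ideal.span {f | ∃ c ∈ fs, laurentOfCode ν c = f} := by
  have key : ∀ w, O.represents fs g w = true ↔
      laurentOfCode ν (O.combination fs w) = laurentOfCode ν g := by
    intro w
    have h1 : (AddMonoidAlgebra.single 0 (-1) : PosynomialRing K ℤ n) = -1 := by
      rw [AddMonoidAlgebra.single_neg, ← AddMonoidAlgebra.one_def]
    rw [represents, codeEqZero_iff, laurentOfCode_append, laurentOfCode_termMul, O.val_negOne,
      h1, neg_one_mul, ← sub_eq_add_neg, sub_eq_zero]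
  constructor
  · rintro ⟨w, hw⟩
    rw [← (key w).1 hw]
    exact O.laurentOfCode_combination_mem fs w
  · intro hg
    obtain ⟨w, hw⟩ := O.exists_laurentOfCode_combination_eq hν fs hg
    exact ⟨w, (key w).2 hw⟩

end NameOps

/-! ### Decidability over the integers. -/

/-- Membership in finitely generated ideals of Laurent polynomial rings is decidable. -/
theorem IsComputableNumbering.computablePred_laurent_mem_span {K : Type*} [Field K] {ν : ℕ → K}
    (hν : IsComputableNumbering ν) (n : ℕ) :
    ComputablePred fun x : List (PosynomialCode ℤ n) × PosynomialCode ℤ n =>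
      laurentOfCode ν x.2 ∈ Ideal.span {f | ∃ c ∈ x.1, laurentOfCode ν c = f} := by
  obtain ⟨O⟩ := hν.nonempty_nameOps
  -- Post's theorem combines the two searches.
  refine ComputablePred.computable_iff_re_compl_re'.2 ⟨?_, ?_⟩
  · refine REPred.of_eq (REPred.exists_of_computable
      (c := fun (x : List (PosynomialCode ℤ n) × PosynomialCode ℤ n) w =>
        O.represents x.1 x.2 w) ?_) fun x => O.exists_represents_iff hν.surjective x.1 x.2
    exact O.computable_represents (Computable.fst.comp .fst) (Computable.snd.comp .fst) .snd
  · refine REPred.of_eq (REPred.exists_of_computable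
      (c := fun (x : List (PosynomialCode ℤ n) × PosynomialCode ℤ n)
        (w : ℕ × (Fin n → List ℕ) × (Fin n → List ℕ)) =>
        O.separates x.1 x.2 w.1 w.2.1 w.2.2) ?_)
        fun x => O.exists_separates_iff hν.surjective x.1 x.2
    exact O.computable_separates (Computable.fst.comp .fst) (Computable.snd.comp .fst)
      (Computable.fst.comp .snd) (Computable.fst.comp (Computable.snd.comp .snd))
      (Computable.snd.comp (Computable.snd.comp .snd))

/-! ### Contraction of extended ideals for group rings of subgroups. -/

/-- An ideal of a commutative ring is the contraction of its extension along a homomorphism that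
has a linear retraction. -/
theorem Ideal.map_mem_span_image_iff_of_retraction {R S : Type*} [CommRing R] [CommRing S]
    (φ : R →+* S) (π : S →+ R) (hπ : ∀ a b, π (φ a * b) = a * π b) (hone : π 1 = 1)
    (F : Set R) (g : R) : φ g ∈ Ideal.span (φ '' F) ↔ g ∈ Ideal.span F := by
  constructor
  · intro h
    -- The extra factor `s` lets the induction pass through multiplication by elements outside the
    -- subring, over which `π` is not linear.
    have key : ∀ x ∈ Ideal.span (φ '' F), ∀ s, π (s * x) ∈ Ideal.span F := by
      intro x hx
      induction hx using Submodule.span_induction with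
      | mem x hx =>
        obtain ⟨f, hf, rfl⟩ := hx
        intro s
        rw [mul_comm, hπ]
        exact Ideal.mul_mem_right _ _ (Ideal.subset_span hf)
      | zero => simp
      | add x y _ _ hx hy =>
        intro s
        rw [mul_add, map_add]
        exact add_mem (hx s) (hy s)
      | smul a x _ hx =>
        intro s
        rw [smul_eq_mul, ← mul_assoc]
        exact hx _
    have h1 := hπ g 1
    rw [hone, mul_one, mul_one] at h1
    simpa [h1] using key _ h 1
  · intro h
    rw [← Ideal.map_span]
    exact Ideal.mem_map_of_mem φ h

namespace AddMonoidAlgebra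

theorem comapDomain_single_of_notMem_range {K H G : Type*} [CommRing K] (f : H → G)
    (hf : Function.Injective f) {t : G} (ht : t ∉ Set.range f) (c : K) :
    comapDomain f hf (single t c) = 0 := by
  ext s
  have : t ≠ f s := fun h => ht ⟨s, h.symm⟩
  simp [this]

/-- For a subgroup `H` of `G`, given by an injective homomorphism, the projection of `K[G]` to
`K[H]` is `K[H]`-linear. -/
theorem comapDomain_mapDomain_mul {K H G : Type*} [CommRing K] [AddCommGroup H]
    [AddCommGroup G] (f : H →+ G) (hf : Function.Injective f) (a : AddMonoidAlgebra K H)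
    (b : AddMonoidAlgebra K G) :
    comapDomain f hf (mapDomain f a * b) = a * comapDomain f hf b := by
  induction a using induction_linear with
  | zero => simp
  | add a a' h h' => rw [mapDomain_add, add_mul, comapDomain_add, h, h', add_mul]
  | single s c =>
    induction b using induction_linear with
    | zero => simp
    | add b b' h h' => rw [mul_add, comapDomain_add, h, h', comapDomain_add, mul_add]
    | single t c' =>
      rw [mapDomain_single, single_mul_single]
      by_cases ht : t ∈ Set.range f
      · obtain ⟨t, rfl⟩ := ht
        rw [← map_add, comapDomain_single_map, comapDomain_single_map, single_mul_single]
      · rw [comapDomain_single_of_notMem_range f hf ht,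
          comapDomain_single_of_notMem_range f hf, mul_zero]
        -- Translation by an element of the subgroup preserves its complement; this is where
        -- subtraction in `H` enters.
        rintro ⟨u, hu⟩
        exact ht ⟨u - s, by rw [map_sub, hu, add_sub_cancel_left]⟩

theorem mapDomain_mem_span_image_iff {K H G : Type*} [CommRing K] [AddCommGroup H]
    [AddCommGroup G] (f : H →+ G) (hf : Function.Injective f) (F : Set (AddMonoidAlgebra K H))
    (g : AddMonoidAlgebra K H) :
    mapDomain f g ∈ Ideal.span (mapDomain f '' F) ↔ g ∈ Ideal.span F := by
  refine Ideal.map_mem_span_image_iff_of_retraction (mapDomainRingHom K f)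
    (comapDomainAddMonoidHom f hf) (comapDomain_mapDomain_mul f hf) ?_ F g
  change comapDomain f hf 1 = 1
  rw [one_def, ← map_zero f, comapDomain_single_map, one_def]

end AddMonoidAlgebra

/-! ### Clearing denominators in the exponents. -/

section Scale

variable {n : ℕ}

/-- The homomorphism `s ↦ s / N` from `ℤⁿ` to `ℚⁿ`. -/
def divHom (n N : ℕ) : (Fin n → ℤ) →+ (Fin n → ℚ) where
  toFun s i := (s i : ℚ) / N
  map_zero' := by ext; simp
  map_add' s t := by ext; simp [add_div]

theorem divHom_injective {N : ℕ} (hN : N ≠ 0) : Function.Injective (divHom n N) := by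
  intro s t h
  ext i
  have hN' : (N : ℚ) ≠ 0 := Nat.cast_ne_zero.2 hN
  have := congrFun h i
  simpa [divHom, div_left_inj' hN'] using this

/-- The list of terms with all exponents multiplied by `N`, a common denominator. -/
def scaleCode (N : ℕ) (c : PosynomialCode (ℤ × ℕ) n) : PosynomialCode ℤ n :=
  c.map fun t => (t.1, fun i => (t.2 i).1 * ((N / ((t.2 i).2 + 1) : ℕ) : ℤ))

/-- The product of the denominators in the exponents. -/
def denomProd (c : PosynomialCode (ℤ × ℕ) n) : ℕ :=
  c.foldl (fun m t => (List.finRange n).foldl (fun m i => m * ((t.2 i).2 + 1)) m) 1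

/-- The natural-number division in `scaleCode` is exact because each denominator divides `N`. -/
theorem mapDomain_divHom_scaleCode {K : Type*} [Field K] (ν : ℕ → K) {N : ℕ} (hN : N ≠ 0)
    (c : PosynomialCode (ℤ × ℕ) n) (hc : ∀ t ∈ c, ∀ i, (t.2 i).2 + 1 ∣ N) :
    AddMonoidAlgebra.mapDomain (divHom n N) (laurentOfCode ν (scaleCode N c)) =
      posynomialOfCode ν c := by
  induction c with
  | nil => simp [laurentOfCode, posynomialOfCode, scaleCode]
  | cons t c ih =>
    have h := ih fun t' ht' => hc t' (List.mem_cons_of_mem _ ht')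
    have ht := hc t List.mem_cons_self
    simp only [laurentOfCode, posynomialOfCode, scaleCode, List.map_cons, List.sum_cons,
      AddMonoidAlgebra.mapDomain_add, AddMonoidAlgebra.mapDomain_single] at h ⊢
    rw [h]
    congr 2
    ext i
    obtain ⟨k, hk⟩ := ht i
    have hk0 : (k : ℚ) ≠ 0 := by
      rintro h0
      simp_all
    have hb : (((t.2 i).2 : ℚ) + 1) ≠ 0 := by positivity
    simp only [divHom, AddMonoidHom.coe_mk, ZeroHom.coe_mk, ratOfPair]
    rw [hk, Nat.mul_div_cancel_left _ (Nat.succ_pos _)]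
    push_cast
    field_simp

theorem List.foldl_mul_eq_mul_prod {ι : Type*} (l : List ι) (f : ι → ℕ) (m : ℕ) :
    l.foldl (fun m i => m * f i) m = m * (l.map f).prod := by
  induction l generalizing m with
  | nil => simp
  | cons a l ih => simp [ih, mul_assoc]

theorem denomProd_eq (c : PosynomialCode (ℤ × ℕ) n) :
    denomProd c =
      (c.map fun t => ((List.finRange n).map fun i => (t.2 i).2 + 1).prod).prod := by
  simp only [denomProd, List.foldl_mul_eq_mul_prod, one_mul]

theorem denomProd_ne_zero (c : PosynomialCode (ℤ × ℕ) n) : denomProd c ≠ 0 := by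
  simp [denomProd_eq, List.prod_eq_zero_iff]

theorem dvd_denomProd {c : PosynomialCode (ℤ × ℕ) n} {t : ℕ × (Fin n → ℤ × ℕ)} (ht : t ∈ c)
    (i : Fin n) : (t.2 i).2 + 1 ∣ denomProd c := by
  rw [denomProd_eq]
  have hi : (t.2 i).2 + 1 ∣ ((List.finRange n).map fun i => (t.2 i).2 + 1).prod :=
    List.dvd_prod (List.mem_map.2 ⟨i, List.mem_finRange i, rfl⟩)
  exact hi.trans (List.dvd_prod (List.mem_map.2 ⟨t, ht, rfl⟩))

theorem primrec_scaleCode : Primrec₂ (scaleCode (n := n)) := by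
  refine Primrec.list_map (g := fun (p : ℕ × PosynomialCode (ℤ × ℕ) n)
    (t : ℕ × (Fin n → ℤ × ℕ)) =>
      (t.1, fun i => (t.2 i).1 * ((p.1 / ((t.2 i).2 + 1) : ℕ) : ℤ))) .snd ?_
  refine Primrec.pair (Primrec.fst.comp .snd) (Primrec.fin_curry.2 ?_)
  have ht : Primrec fun q : ((ℕ × PosynomialCode (ℤ × ℕ) n) × ℕ × (Fin n → ℤ × ℕ)) × Fin n =>
      q.1.2.2 q.2 :=
    Primrec.fin_app.comp (Primrec.snd.comp (Primrec.snd.comp .fst)) .snd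
  exact Primrec.int_mul_natCast.comp (Primrec.fst.comp ht)
    (Primrec.nat_div.comp (Primrec.fst.comp (Primrec.fst.comp .fst))
      (Primrec.succ.comp (Primrec.snd.comp ht)))

theorem primrec_denomProd : Primrec (denomProd (n := n)) := by
  have ht : Primrec fun q : (PosynomialCode (ℤ × ℕ) n × ℕ × ℕ × (Fin n → ℤ × ℕ)) × ℕ × Fin n =>
      q.1.2.2.2 q.2.2 :=
    Primrec.fin_app.comp (Primrec.snd.comp (Primrec.snd.comp (Primrec.snd.comp .fst)))
      (Primrec.snd.comp .snd)
  have hin : Primrec₂ fun (_ : PosynomialCode (ℤ × ℕ) n) (p : ℕ × ℕ × (Fin n → ℤ × ℕ)) =>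
      (List.finRange n).foldl (fun m i => m * ((p.2.2 i).2 + 1)) p.1 :=
    Primrec.list_foldl
      (h := fun (q : PosynomialCode (ℤ × ℕ) n × ℕ × ℕ × (Fin n → ℤ × ℕ)) (r : ℕ × Fin n) =>
        r.1 * ((q.2.2.2 r.2).2 + 1))
      (Primrec.const (List.finRange n)) (Primrec.fst.comp .snd)
      (Primrec.nat_mul.comp (Primrec.fst.comp .snd) (Primrec.succ.comp (Primrec.snd.comp ht)))
  exact Primrec.list_foldl Primrec.id (Primrec.const 1) hin

/-- One denominator must serve `g` and all generators, so that they lie in the group ring of a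
single lattice `(1/N)ℤⁿ`. -/
theorem posynomial_mem_span_iff {K : Type*} [Field K] (ν : ℕ → K)
    (fs : List (PosynomialCode (ℤ × ℕ) n)) (g : PosynomialCode (ℤ × ℕ) n) :
    posynomialOfCode ν g ∈ Ideal.span {f | ∃ c ∈ fs, posynomialOfCode ν c = f} ↔
      laurentOfCode ν (scaleCode (denomProd (g ++ fs.flatten)) g) ∈ Ideal.span
        {f | ∃ c ∈ fs.map (scaleCode (denomProd (g ++ fs.flatten))), laurentOfCode ν c = f} := by
  set N := denomProd (g ++ fs.flatten)
  have hN : N ≠ 0 := denomProd_ne_zero _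
  have hg := mapDomain_divHom_scaleCode ν hN g fun t ht i =>
    dvd_denomProd (List.mem_append_left _ ht) i
  have hfs : ∀ c ∈ fs, _ := fun c hc => mapDomain_divHom_scaleCode ν hN c fun t ht i =>
    dvd_denomProd (List.mem_append_right _ (List.mem_flatten_of_mem hc ht)) i
  rw [← AddMonoidAlgebra.mapDomain_mem_span_image_iff (divHom n N) (divHom_injective hN), hg]
  have hset : {f | ∃ c ∈ fs, posynomialOfCode ν c = f} =
      AddMonoidAlgebra.mapDomain (divHom n N) ''
        {f | ∃ c ∈ fs.map (scaleCode N), laurentOfCode ν c = f} := by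
    ext f
    constructor
    · rintro ⟨c, hc, rfl⟩
      exact ⟨_, ⟨_, List.mem_map_of_mem hc, rfl⟩, hfs c hc⟩
    · rintro ⟨_, ⟨_, hc', rfl⟩, rfl⟩
      obtain ⟨c, hc, rfl⟩ := List.mem_map.1 hc'
      exact ⟨c, hc, (hfs c hc).symm⟩
  rw [hset]

end Scale

/-! ### Arbitrary ideals and the final assembly. -/

theorem exists_laurentOfCode_eq {K : Type*} [Field K] {ν : ℕ → K} (hν : Function.Surjective ν)
    {n : ℕ} (f : PosynomialRing K ℤ n) : ∃ c, laurentOfCode ν c = f := by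
  induction f using AddMonoidAlgebra.induction_linear with
  | zero => exact ⟨[], rfl⟩
  | add f g hf hg =>
    obtain ⟨c, rfl⟩ := hf
    obtain ⟨c', rfl⟩ := hg
    exact ⟨_, NameOps.laurentOfCode_append c c'⟩
  | single s a =>
    obtain ⟨r, rfl⟩ := hν a
    exact ⟨[(r, s)], by simp [laurentOfCode]⟩

theorem exists_list_span_eq {K : Type*} [Field K] {ν : ℕ → K} (hν : Function.Surjective ν)
    {n : ℕ} (I : Ideal (PosynomialRing K ℤ n)) :
    ∃ fs : List (PosynomialCode ℤ n), Ideal.span {f | ∃ c ∈ fs, laurentOfCode ν c = f} = I := by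
  have : IsNoetherianRing (PosynomialRing K ℤ n) := Algebra.FiniteType.isNoetherianRing K _
  obtain ⟨F, rfl⟩ := (isNoetherianRing_iff_ideal_fg _).1 this I
  choose c hc using exists_laurentOfCode_eq (n := n) hν
  refine ⟨F.toList.map c, congrArg Ideal.span ?_⟩
  ext f
  simp [hc]

theorem theorem5p3 {K : Type*} [Field K] (ν : ℕ → K) (hν : IsComputableNumbering ν) (n : ℕ) :
    -- every ideal of the Laurent polynomial ring is a recursive set
    (∀ I : Ideal (PosynomialRing K ℤ n),
      ComputablePred fun g : PosynomialCode ℤ n => laurentOfCode ν g ∈ I) ∧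
    -- uniformly: one algorithm takes generators and a Laurent polynomial and decides membership
    (ComputablePred fun x : List (PosynomialCode ℤ n) × PosynomialCode ℤ n =>
      laurentOfCode ν x.2 ∈ Ideal.span {f | ∃ c ∈ x.1, laurentOfCode ν c = f}) ∧
    -- the same for finitely generated ideals of the posynomial ring with rational exponents
    (ComputablePred fun x : List (PosynomialCode (ℤ × ℕ) n) × PosynomialCode (ℤ × ℕ) n =>
      posynomialOfCode ν x.2 ∈ Ideal.span {f | ∃ c ∈ x.1, posynomialOfCode ν c = f}) := by
  have main := hν.computablePred_laurent_mem_span n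
  refine ⟨fun I => ?_, main, ?_⟩
  -- The generators may be chosen non-effectively: for a fixed ideal they are a constant of the
  -- algorithm.
  · obtain ⟨fs, rfl⟩ := exists_list_span_eq hν.surjective I
    exact main.comp (f := fun g => (fs, g)) ((Computable.const fs).pair .id)
  · have hN : Primrec fun x : List (PosynomialCode (ℤ × ℕ) n) × PosynomialCode (ℤ × ℕ) n =>
        denomProd (x.2 ++ x.1.flatten) :=
      primrec_denomProd.comp (Primrec.list_append.comp .snd (Primrec.list_flatten.comp .fst))
    have hscale : Primrec fun x : List (PosynomialCode (ℤ × ℕ) n) × PosynomialCode (ℤ × ℕ) n =>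
        (x.1.map (scaleCode (denomProd (x.2 ++ x.1.flatten))),
          scaleCode (denomProd (x.2 ++ x.1.flatten)) x.2) :=
      (Primrec.list_map .fst (primrec_scaleCode.comp (hN.comp .fst) .snd).to₂).pair
        (primrec_scaleCode.comp hN .snd)
    exact (main.comp hscale.to_comp).of_eq fun x => (posynomial_mem_span_iff ν x.1 x.2).symm
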